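/- Let $H$ be a complex Hilbert space and let $A_o : D(A_o)\subset H\to H$ be a self-adjoint, positive-definite operator with $0\in\rho(A_o)$. Let $V=D(A_o^{1/2})$ with the inner product $\langle x,z\rangle_V=\langle A_o^{1/2}x,A_o^{1/2}z\rangle_H$, and on the Hilbert space $\mathcal Z=V\times H$ let $$A=\begin{pmatrix}0&I\\-A_o&0\end{pmatrix},\quad D(A)=D(A_o)\times V,\qquad B=\begin{pmatrix}0\\F\end{pmatrix},\quad Fu=fu\ (u\in\mathbb C),\ f\in H.$$ Assume that the spectrum $\sigma(A)$ has no finite accumulation point and consists of eigenvalues of finite algebraic multiplicity only. The invariant zeros of the system $\Sigma(A,B,B^*)$ (that is, $\dot x=Ax+Bu$, $y=B^*x$) are the $\mu\in\mathbb C$ for which there are $x\in D(A)\setminus\{0\}$ and $u\in\mathbb C$ with $(\mu I-A)x-Bu=0$ and $B^*x=0$. Assume that the system is minimal, that is, no invariant zero belongs to $\sigma(A)$, and that $f\in D(A_o^{3/8})$. Then there is a constant $M>0$ such that for every invariant zero $\mu$ of $\Sigma(A,B,B^*)$ there is an eigenvalue $\lambda$ of $A$ with $$|\mu-\lambda|<\frac{M}{\sqrt{|\mu|}},$$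 where for $\mu=0$ the right-hand side is read as $+\infty$ (so that the inequality is no restriction for $\mu=0$). -/

import Mathlib

noncomputable section

namespace SISO

section Operators

variable {Z : Type*} [NormedAddCommGroup Z] [InnerProductSpace ℂ Z]

/-- `R` is a bounded two-sided inverse of `s I - A : D(A) → Z`. -/
def IsResolventOf (A : Z →ₗ.[ℂ] Z) (s : ℂ) (R : Z →L[ℂ] Z) : Prop :=
  (∀ y : Z, ∃ x : A.domain, (x : Z) = R y ∧ s • (x : Z) - A x = y) ∧
    ∀ x : A.domain, R (s • (x : Z) - A x) = x

/-- The resolvent set of an unbounded operator. -/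
def resolventSet (A : Z →ₗ.[ℂ] Z) : Set ℂ :=
  {s | ∃ R : Z →L[ℂ] Z, IsResolventOf A s R}

/-- The spectrum of an unbounded operator. -/
def spec (A : Z →ₗ.[ℂ] Z) : Set ℂ := (resolventSet A)ᶜ

/-- `s` is an eigenvalue of the unbounded operator `A`. -/
def IsEigenvalue (A : Z →ₗ.[ℂ] Z) (s : ℂ) : Prop :=
  ∃ x : A.domain, (x : Z) ≠ 0 ∧ A x = s • (x : Z)

/-- The kernel of `(s I - A) ^ n`, with its natural domain. -/
def genKer (A : Z →ₗ.[ℂ] Z) (s : ℂ) : ℕ → Submodule ℂ Z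
  | 0 => ⊥
  | n + 1 => ((genKer A s n).comap (s • A.domain.subtype - A.toFun)).map A.domain.subtype

/-- The spectrum has no finite accumulation point and consists of eigenvalues of finite algebraic
multiplicity (the dimension of the union of the kernels of the powers of `s I - A`). -/
def HasDiscreteSpectrum (A : Z →ₗ.[ℂ] Z) : Prop :=
  (∀ z : ℂ, ¬ AccPt z (Filter.principal (spec A))) ∧
    ∀ s ∈ spec A, IsEigenvalue A s ∧ FiniteDimensional ℂ ↥(⨆ n, genKer A s n)

/-- The invariant zeros of the system `x' = A x + B u`, `y = C x + D u` with scalar input and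
output. -/
def invariantZeros (A : Z →ₗ.[ℂ] Z) (B : ℂ →L[ℂ] Z) (C : Z →L[ℂ] ℂ) (D : ℂ) : Set ℂ :=
  {s | ∃ (x : A.domain) (u : ℂ), (x : Z) ≠ 0 ∧
    s • (x : Z) - A x - B u = 0 ∧ C (x : Z) + D * u = 0}

/-- A system is minimal if none of its invariant zeros lies in the spectrum of `A`. -/
def IsMinimal (A : Z →ₗ.[ℂ] Z) (B : ℂ →L[ℂ] Z) (C : Z →L[ℂ] ℂ) (D : ℂ) : Prop :=
  invariantZeros A B C D ∩ spec A = ∅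

end Operators

/-- A stiffness operator: a self-adjoint, positive-definite (unbounded) operator on a Hilbert space
with zero in its resolvent set. -/
structure StiffnessOperator (H : Type*) [NormedAddCommGroup H] [InnerProductSpace ℂ H]
    [CompleteSpace H] where
  op : H →ₗ.[ℂ] H
  isSelfAdjoint : IsSelfAdjoint op
  pos : ∀ x : op.domain, (x : H) ≠ 0 → 0 < (inner ℂ (op x) (x : H)).re
  zero_mem : (0 : ℂ) ∈ resolventSet op

namespace StiffnessOperator

variable {H : Type*} [NormedAddCommGroup H] [InnerProductSpace ℂ H] [CompleteSpace H]
variable (T : StiffnessOperator H)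

/-- The bounded inverse of a stiffness operator, that is `-(0 I - T)⁻¹`. -/
def inv : H →L[ℂ] H := -T.zero_mem.choose

theorem inv_spec (y : H) : ∃ x : T.op.domain, (x : H) = T.inv y ∧ T.op x = y := by
  obtain ⟨x, hx, h⟩ := T.zero_mem.choose_spec.1 y
  refine ⟨-x, by simp [inv, hx], ?_⟩
  rw [LinearPMap.map_neg, ← h]
  simp

theorem inv_op (x : T.op.domain) : T.inv (T.op x) = x := by
  have h := T.zero_mem.choose_spec.2 x
  rw [zero_smul, zero_sub, map_neg] at h
  simpa [inv] using h

theorem inv_injective : Function.Injective T.inv := by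
  intro y z h
  obtain ⟨x, hx, rfl⟩ := T.inv_spec y
  obtain ⟨x', hx', rfl⟩ := T.inv_spec z
  rw [T.inv_op, T.inv_op] at h
  rw [Subtype.ext h]

theorem inner_op_symm (x y : T.op.domain) :
    inner ℂ (T.op x) (y : H) = inner ℂ (x : H) (T.op y) := by
  have h := LinearPMap.adjoint_isFormalAdjoint T.isSelfAdjoint.dense_domain
  rw [LinearPMap.isSelfAdjoint_def.mp T.isSelfAdjoint] at h
  exact h x y

theorem inv_nonneg : 0 ≤ T.inv := by
  rw [ContinuousLinearMap.nonneg_iff_isPositive, ContinuousLinearMap.isPositive_def]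
  refine ⟨fun y z => ?_, fun y => ?_⟩
  · obtain ⟨x, hx, rfl⟩ := T.inv_spec y
    obtain ⟨x', hx', rfl⟩ := T.inv_spec z
    simpa [T.inv_op] using (T.inner_op_symm x x').symm
  · obtain ⟨x, hx, rfl⟩ := T.inv_spec y
    rw [ContinuousLinearMap.reApplyInnerSelf_apply, T.inv_op, inner_re_symm]
    by_cases h : (x : H) = 0
    · simp [h]
    · exact (T.pos x h).le

/-- The fractional power `T ^ α`, `0 ≤ α`, as an unbounded operator: it is the inverse of the
bounded injective operator `(T⁻¹) ^ α` given by the continuous functional calculus, so that its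
domain is the range of `(T⁻¹) ^ α`. -/
def fracPow (α : ℝ) : H →ₗ.[ℂ] H :=
  (((T.inv ^ α : H →L[ℂ] H) : H →ₗ[ℂ] H).toPMap ⊤).inverse

theorem mem_fracPow_domain (α : ℝ) (x : H) :
    x ∈ (T.fracPow α).domain ↔ ∃ y, (T.inv ^ α : H →L[ℂ] H) y = x := by
  rw [fracPow, LinearPMap.inverse_domain]
  simp [LinearMap.toPMap]

theorem inv_half_injective : Function.Injective (T.inv ^ (1 / 2 : ℝ) : H →L[ℂ] H) := by
  have h : (T.inv ^ (1 / 2 : ℝ) : H →L[ℂ] H) * (T.inv ^ (1 / 2 : ℝ) : H →L[ℂ] H) = T.inv := by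
    rw [← CFC.sqrt_eq_rpow]
    exact CFC.sqrt_mul_sqrt_self _ T.inv_nonneg
  intro y z hyz
  apply T.inv_injective
  rw [← h]
  change (T.inv ^ (1 / 2 : ℝ) : H →L[ℂ] H) ((T.inv ^ (1 / 2 : ℝ) : H →L[ℂ] H) y) =
    (T.inv ^ (1 / 2 : ℝ) : H →L[ℂ] H) ((T.inv ^ (1 / 2 : ℝ) : H →L[ℂ] H) z)
  rw [hyz]

theorem fracPow_half_apply (x : (T.fracPow (1 / 2)).domain) (y : H)
    (h : (T.inv ^ (1 / 2 : ℝ) : H →L[ℂ] H) y = x) : T.fracPow (1 / 2) x = y := by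
  have hk : (((T.inv ^ (1 / 2 : ℝ) : H →L[ℂ] H) : H →ₗ[ℂ] H).toPMap ⊤).toFun.ker = ⊥ := by
    rw [LinearMap.ker_eq_bot]
    intro a b hab
    exact Subtype.ext (T.inv_half_injective hab)
  exact LinearPMap.inverse_apply_eq (y := x) hk (x := ⟨y, trivial⟩) h

/-- The space `V = D(T ^ (1/2))`; its inner product is
`⟪x, z⟫_V = ⟪T ^ (1/2) x, T ^ (1/2) z⟫`. -/
def EnergySpace : Type _ := (T.fracPow (1 / 2)).domain

instance : AddCommGroup T.EnergySpace :=
  inferInstanceAs (AddCommGroup (T.fracPow (1 / 2)).domain)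

instance : Module ℂ T.EnergySpace :=
  inferInstanceAs (Module ℂ (T.fracPow (1 / 2)).domain)

/-- The inclusion of `V` into `H`. -/
def incl : T.EnergySpace →ₗ[ℂ] H := (T.fracPow (1 / 2)).domain.subtype

/-- `T ^ (1/2)` as a linear map from `V` to `H`. -/
def sqrtMap : T.EnergySpace →ₗ[ℂ] H := (T.fracPow (1 / 2)).toFun

theorem inv_half_sqrtMap (x : T.EnergySpace) :
    (T.inv ^ (1 / 2 : ℝ) : H →L[ℂ] H) (T.sqrtMap x) = T.incl x := by
  obtain ⟨y, hy⟩ := (T.mem_fracPow_domain (1 / 2) _).1 (Subtype.prop x)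
  have h : T.sqrtMap x = y := T.fracPow_half_apply x y hy
  rw [h]
  exact hy

theorem sqrtMap_injective : Function.Injective T.sqrtMap := by
  intro x y h
  apply Subtype.ext
  have h2 : T.incl x = T.incl y := by
    rw [← T.inv_half_sqrtMap, ← T.inv_half_sqrtMap, h]
  exact h2

theorem sqrtMap_surjective : Function.Surjective T.sqrtMap := fun y =>
  ⟨⟨(T.inv ^ (1 / 2 : ℝ) : H →L[ℂ] H) y, (T.mem_fracPow_domain _ _).2 ⟨y, rfl⟩⟩,
    T.fracPow_half_apply _ y rfl⟩

instance : NormedAddCommGroup T.EnergySpace :=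
  NormedAddCommGroup.induced T.EnergySpace H T.sqrtMap T.sqrtMap_injective

instance : InnerProductSpace ℂ T.EnergySpace where
  norm_smul_le c x := by
    change ‖T.sqrtMap (c • x)‖ ≤ ‖c‖ * ‖T.sqrtMap x‖
    rw [map_smul, norm_smul]
  inner x z := inner ℂ (T.sqrtMap x) (T.sqrtMap z)
  norm_sq_eq_re_inner x := norm_sq_eq_re_inner (𝕜 := ℂ) (T.sqrtMap x)
  conj_inner_symm x y := inner_conj_symm _ _
  add_left x y z := by rw [map_add, inner_add_left]
  smul_left x y r := by rw [map_smul, inner_smul_left]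

instance : CompleteSpace T.EnergySpace := by
  let e : T.EnergySpace ≃ₗᵢ[ℂ] H :=
    { LinearEquiv.ofBijective T.sqrtMap ⟨T.sqrtMap_injective, T.sqrtMap_surjective⟩ with
      norm_map' := fun _ => rfl }
  exact (completeSpace_congr (e := e.toLinearEquiv.toEquiv) e.isometry.isUniformEmbedding).2
    inferInstance

/-- The state space `V × H` with its Hilbert space inner product. -/
abbrev State : Type _ := WithLp 2 (T.EnergySpace × H)

/-- The domain `D(T) × V` of the second-order generator. -/
def genDomain : Submodule ℂ T.State where
  carrier := {z | T.incl z.fst ∈ T.op.domain ∧ z.snd ∈ (T.fracPow (1 / 2)).domain}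
  zero_mem' := by simp
  add_mem' := by
    rintro a b ⟨h1, h2⟩ ⟨h3, h4⟩
    exact ⟨by simpa using add_mem h1 h3, by simpa using add_mem h2 h4⟩
  smul_mem' := by
    rintro c a ⟨h1, h2⟩
    exact ⟨by simpa using Submodule.smul_mem _ c h1, by simpa using Submodule.smul_mem _ c h2⟩

/-- The second-order generator `A (w, v) = (v, - T w)` on `V × H`, with domain `D(T) × V`. -/
def generator : T.State →ₗ.[ℂ] T.State where
  domain := T.genDomain
  toFun :=
    { toFun := fun z => WithLp.toLp 2
        ((⟨(z : T.State).snd, z.2.2⟩ : (T.fracPow (1 / 2)).domain),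
          -T.op ⟨T.incl (z : T.State).fst, z.2.1⟩)
      map_add' := by
        intro a b
        apply (WithLp.equiv 2 _).injective
        refine Prod.ext rfl ?_
        change -T.op _ = -T.op _ + -T.op _
        rw [← neg_add, ← LinearPMap.map_add]
        congr 2
      map_smul' := by
        intro c a
        apply (WithLp.equiv 2 _).injective
        refine Prod.ext rfl ?_
        change -T.op _ = c • -T.op _
        rw [smul_neg, ← LinearPMap.map_smul]
        congr 2 }

/-- The input operator `B u = (0, F u)`. -/
def inputOp (F : ℂ →L[ℂ] H) : ℂ →L[ℂ] T.State :=
  ((WithLp.prodContinuousLinearEquiv 2 ℂ T.EnergySpace H).symm :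
    T.EnergySpace × H →L[ℂ] T.State) ∘L ((0 : ℂ →L[ℂ] T.EnergySpace).prod F)

end StiffnessOperator

end SISO

end

noncomputable section

namespace SISO

/-! Let `K` be the bounded inverse of the stiffness operator. A nonzero invariant zero `μ` yields `w
≠ 0` with `w = K (u f - μ² w)` and `⟪w, f⟫ = 0`. Positivity of `K` then forces `μ² = -t²` with `t =
‖μ‖`, so zeros lie on the imaginary axis (`eq_neg_norm_of_apply_eq`). Each `x > 0` in the spectrum
of `K` gives the eigenvalues `±i/√x` of the generator (`mem_spec_generator`).

If no eigenvalue is within `d = M/√t` of `μ`, then every such `1/√x` is at distance at least `d`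
from `t`. Hence `w = u Φ f` with `Φ = K (1 - t² K)⁻¹`, and `⟪Φ f, f⟫ = 0`. Frequencies `1/√x` above
`t` contribute positively, but by at most `‖g‖² / (d t^(5/2)) = ‖g‖² / (M t²)`, where `f = K^(3/8)
g`. Those below `t` contribute negatively, by an amount of order `1/t²`, because `⟪K f, f⟫ > 0`. For
large `M` and `t` the two cannot balance (`resolvent_weight_le`, `gap_estimate`). Zeros with bounded
`t` are compared with one fixed eigenvalue. -/

theorem IsEigenvalue.mem_spec {Z : Type*} [NormedAddCommGroup Z] [InnerProductSpace ℂ Z]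
    {A : Z →ₗ.[ℂ] Z} {l : ℂ} (h : IsEigenvalue A l) : l ∈ spec A := by
  rintro ⟨R, -, hR⟩
  obtain ⟨x, hx, hA⟩ := h
  apply hx
  rw [← hR x, hA, sub_self, map_zero]

/-! ### The generator's resolvent equation in terms of the bounded inverse. -/

namespace StiffnessOperator

variable {H : Type*} [NormedAddCommGroup H] [InnerProductSpace ℂ H] [CompleteSpace H]
variable (T : StiffnessOperator H)

theorem inv_mem_domain (y : H) : T.inv y ∈ T.op.domain := by
  obtain ⟨x, hx, -⟩ := T.inv_spec y
  exact hx ▸ x.2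

theorem op_inv (y : H) (h : T.inv y ∈ T.op.domain) : T.op ⟨T.inv y, h⟩ = y := by
  obtain ⟨x, hx, hy⟩ := T.inv_spec y
  have : (⟨T.inv y, h⟩ : T.op.domain) = x := Subtype.ext hx.symm
  rw [this, hy]

theorem inv_mem_fracPow_half_domain (y : H) : T.inv y ∈ (T.fracPow (1 / 2)).domain := by
  rw [mem_fracPow_domain]
  refine ⟨(T.inv ^ (1 / 2 : ℝ) : H →L[ℂ] H) y, ?_⟩
  have h : (T.inv ^ (1 / 2 : ℝ) : H →L[ℂ] H) * (T.inv ^ (1 / 2 : ℝ) : H →L[ℂ] H) = T.inv := by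
    rw [← CFC.sqrt_eq_rpow]
    exact CFC.sqrt_mul_sqrt_self _ T.inv_nonneg
  exact DFunLike.congr_fun h y

/-- The resolvent equation of the generator, reduced to its first component. -/
theorem generator_resolvent_eq {l : ℂ} {y : H} (z : T.generator.domain)
    (h : l • (z : T.State) - T.generator z = WithLp.toLp 2 (0, y)) :
    (z : T.State).snd = l • T.incl (z : T.State).fst ∧
      T.inv (y - l ^ 2 • T.incl (z : T.State).fst) = T.incl (z : T.State).fst := by
  have h1 : l • T.incl (z : T.State).fst - (z : T.State).snd = 0 := by
    have := congrArg (fun p : T.State => T.incl p.fst) h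
    change T.incl (l • (z : T.State).fst - _) = T.incl 0 at this
    rw [map_sub, map_smul, map_zero] at this
    exact this
  have h2 : l • (z : T.State).snd - -T.op ⟨T.incl (z : T.State).fst, z.2.1⟩ = y :=
    congrArg (fun p : T.State => p.snd) h
  have h3 : (z : T.State).snd = l • T.incl (z : T.State).fst := (sub_eq_zero.1 h1).symm
  refine ⟨h3, ?_⟩
  have h4 : y - l ^ 2 • T.incl (z : T.State).fst = T.op ⟨T.incl (z : T.State).fst, z.2.1⟩ := by
    rw [← h2, sub_neg_eq_add, pow_two, ← smul_smul, ← h3, add_sub_cancel_left]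
  rw [h4, T.inv_op]

theorem exists_generator_resolvent_eq {l : ℂ} {w y : H} (h : T.inv (y - l ^ 2 • w) = w) :
    ∃ z : T.generator.domain, T.incl (z : T.State).fst = w ∧
      l • (z : T.State) - T.generator z = WithLp.toLp 2 (0, y) := by
  have hw : w ∈ T.op.domain := h ▸ T.inv_mem_domain _
  have hw' : w ∈ (T.fracPow (1 / 2)).domain := h ▸ T.inv_mem_fracPow_half_domain _
  let e : T.EnergySpace := ⟨w, hw'⟩
  refine ⟨⟨WithLp.toLp 2 (e, l • w), hw, Submodule.smul_mem _ _ hw'⟩, rfl, ?_⟩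
  apply (WithLp.equiv 2 _).injective
  refine Prod.ext ?_ ?_
  · exact sub_self (l • e)
  · change l • l • w - -T.op ⟨w, hw⟩ = y
    have : T.op ⟨w, hw⟩ = y - l ^ 2 • w := by
      have := T.op_inv (y - l ^ 2 • w) (h.symm ▸ hw)
      rw [← this]
      congr 2
      exact h.symm
    rw [this, smul_smul, ← pow_two]
    abel

/-- A resolvent of the generator at `l` would make `x - K` bijective: a kernel vector of `x - K`
lifts to a kernel vector of `l - A`, and solving with data `(0, q)` produces a preimage of `q`. -/
theorem mem_spec_generator {x : ℝ} (hx : x ∈ spectrum ℝ T.inv) {l : ℂ} (hl : l ^ 2 * x = -1) :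
    l ∈ spec T.generator := by
  rintro ⟨R, hR1, hR2⟩
  have hx0 : (x : ℂ) ≠ 0 := by
    rintro h
    simp [h] at hl
  have hl' : l ^ 2 = -(x : ℂ)⁻¹ := by
    field_simp
    exact hl
  apply hx
  rw [spectrum.mem_resolventSet_iff, ContinuousLinearMap.isUnit_iff_bijective]
  have key : ∀ p, (algebraMap ℝ (H →L[ℂ] H) x - T.inv) p = (x : ℂ) • p - T.inv p := by
    intro p
    rw [sub_apply, Algebra.algebraMap_eq_smul_one]
    simp
  constructor
  · rw [injective_iff_map_eq_zero]
    intro p hp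
    rw [key, sub_eq_zero] at hp
    have : T.inv (0 - l ^ 2 • p) = p := by
      rw [hl', zero_sub, neg_smul, neg_neg, map_smul, ← hp, smul_smul, inv_mul_cancel₀ hx0,
        one_smul]
    obtain ⟨z, hz, h⟩ := T.exists_generator_resolvent_eq this
    have h0 := hR2 z
    rw [h] at h0
    have : (z : T.State) = 0 := by
      rw [← h0]
      exact map_zero R
    rw [← hz, this]
    exact map_zero T.incl
  · intro q
    obtain ⟨z, -, hz⟩ := hR1 (WithLp.toLp 2 (0, q))
    obtain ⟨-, h⟩ := T.generator_resolvent_eq z hz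
    set w := T.incl (z : T.State).fst
    -- Since `K (q - l² w) = w` and `l² = -1/x`, applying `x - K` leaves `q - l² w - w/x = q`.
    refine ⟨(x : ℂ)⁻¹ • (q - l ^ 2 • w), ?_⟩
    rw [key, map_smul, h, smul_smul, mul_inv_cancel₀ hx0, one_smul, hl', neg_smul]
    abel

end StiffnessOperator

/-! ### Spectral estimates for a bounded positive operator. -/

section Bounded

variable {H : Type*} [NormedAddCommGroup H] [InnerProductSpace ℂ H] [CompleteSpace H]

theorem exists_pos_mem_spectrum {K : H →L[ℂ] H} (hK : 0 ≤ K) (h0 : K ≠ 0) :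
    ∃ x ∈ spectrum ℝ K, 0 < x := by
  by_contra! h
  apply h0
  have hsa : IsSelfAdjoint K := hK.isSelfAdjoint
  rw [← cfc_id ℝ K, ← cfc_zero ℝ K]
  refine cfc_congr fun x hx => ?_
  exact le_antisymm (h x hx) (spectrum_nonneg_of_nonneg hK hx)

/-- With `r = 1/√x` the middle factor `x / (1 - t² x)` is `1/(r² - t²)`. For `r > t` it is at most
`1/(d t)`; for `r < t` it is at most `-1/t²`. The subtracted affine function of `x` is nonpositive
in the first range and at most `1/t²` in the second, so it records part of the negative contribution
in a form that can be evaluated on `f`. -/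
theorem resolvent_weight_le {x d t N : ℝ} (hx : 0 ≤ x) (hxN : x ≤ N) (hd : 0 < d) (ht : 0 < t)
    (hgap : 0 < x → d ≤ |1 / √x - t|) :
    x ^ (3 / 8 : ℝ) * (x / (1 - t ^ 2 * x)) * x ^ (3 / 8 : ℝ) ≤
      1 / (d * t * √t ^ 3) -
        x ^ (3 / 8 : ℝ) * ((x - 1 / t ^ 2) / (t ^ 2 * N)) * x ^ (3 / 8 : ℝ) := by
  rcases hx.eq_or_lt with rfl | hx
  -- The point `0` may be spectral and has no gap hypothesis, but the weight vanishes there.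
  · have : (0 : ℝ) ^ (3 / 8 : ℝ) = 0 := Real.zero_rpow (by norm_num)
    simp only [this, zero_mul, sub_zero]
    positivity
  have hgap := hgap hx
  have hN : 0 < N := hx.trans_le hxN
  set p := x ^ (3 / 8 : ℝ) with hp
  have hp0 : 0 < p := Real.rpow_pos_of_pos hx _
  set r := 1 / √x with hr
  have hr0 : 0 < r := by positivity
  have hxr : x = 1 / r ^ 2 := by
    rw [hr, div_pow, Real.sq_sqrt hx.le]; simp
  rcases lt_or_ge t r with htr | htr
  · have h1 : d ≤ r - t := by rwa [abs_of_pos (sub_pos.2 htr)] at hgap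
    have h2 : x / (1 - t ^ 2 * x) = 1 / ((r - t) * (r + t)) := by
      have : r ^ 2 - t ^ 2 ≠ 0 := by nlinarith
      rw [show (r - t) * (r + t) = r ^ 2 - t ^ 2 by ring, hxr]
      field_simp
    have h3 : x / (1 - t ^ 2 * x) ≤ 1 / (d * t) := by
      rw [h2]
      gcongr
      linarith
    have h4 : x ≤ 1 / t ^ 2 := by
      rw [hxr]
      gcongr
    -- The exponent `3/8` enters here: `x ≤ t⁻²` gives `x^(3/4) ≤ t^(-3/2)`.
    have h5 : p * p ≤ 1 / √t ^ 3 := by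
      rw [hp, ← Real.rpow_add hx]
      calc x ^ (3 / 8 + 3 / 8 : ℝ) ≤ (1 / t ^ 2) ^ (3 / 8 + 3 / 8 : ℝ) := by gcongr
        _ = 1 / √t ^ 3 := by
          rw [Real.sqrt_eq_rpow, ← Real.rpow_natCast, ← Real.rpow_natCast, ← Real.rpow_mul ht.le,
            Real.div_rpow zero_le_one (by positivity), Real.one_rpow, ← Real.rpow_mul ht.le]
          norm_num
    have h6 : p * (x / (1 - t ^ 2 * x)) * p ≤ 1 / (d * t * √t ^ 3) := by
      calc p * (x / (1 - t ^ 2 * x)) * p = (x / (1 - t ^ 2 * x)) * (p * p) := by ring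
        _ ≤ 1 / (d * t) * (1 / √t ^ 3) := by gcongr
        _ = _ := by rw [one_div_mul_one_div]
    have h7 : p * ((x - 1 / t ^ 2) / (t ^ 2 * N)) * p ≤ 0 := by
      have : (x - 1 / t ^ 2) / (t ^ 2 * N) ≤ 0 :=
        div_nonpos_of_nonpos_of_nonneg (by linarith) (by positivity)
      nlinarith [mul_pos hp0 hp0]
    linarith
  · have htr' : r < t := by
      rcases htr.lt_or_eq with h | h
      · exact h
      · rw [h, sub_self, abs_zero] at hgap
        linarith
    have h1 : x / (1 - t ^ 2 * x) = -(1 / (t ^ 2 - r ^ 2)) := by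
      have : r ^ 2 - t ^ 2 ≠ 0 := by nlinarith
      have : t ^ 2 - r ^ 2 ≠ 0 := by nlinarith
      rw [hxr, ← one_div_neg_eq_neg_one_div, neg_sub]
      field_simp
    have h2 : 1 / t ^ 2 ≤ 1 / (t ^ 2 - r ^ 2) := by
      have : 0 < t ^ 2 - r ^ 2 := by nlinarith
      gcongr
      nlinarith
    have h3 : (x - 1 / t ^ 2) / (t ^ 2 * N) ≤ 1 / t ^ 2 := by
      rw [div_le_div_iff₀ (by positivity) (by positivity)]
      have : 0 < 1 / t ^ 2 := by positivity
      nlinarith [pow_pos ht 2]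
    have h4 : 0 ≤ 1 / (d * t * √t ^ 3) := by positivity
    have h5 : x / (1 - t ^ 2 * x) + (x - 1 / t ^ 2) / (t ^ 2 * N) ≤ 0 := by linarith
    nlinarith [mul_pos hp0 hp0]

-- Put `y = u f - m w`. Then `0 ≤ ⟪y, K y⟫ = ⟪y, w⟫`, and orthogonality reduces this to `-conj m *
-- ‖w‖²`.
open ComplexOrder in
theorem eq_neg_norm_of_apply_eq {K : H →L[ℂ] H} (hK : 0 ≤ K) {f w : H} {u m : ℂ} (hw : w ≠ 0)
    (hwf : inner ℂ w f = 0) (hwK : K (u • f - m • w) = w) : m = -(‖m‖ : ℂ) := by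
  have h1 := ((ContinuousLinearMap.nonneg_iff_isPositive _).1 hK).inner_nonneg_right
    (u • f - m • w)
  rw [hwK, inner_sub_left, inner_smul_left, inner_smul_left, ← inner_conj_symm, hwf, map_zero,
    mul_zero, zero_sub, inner_self_eq_norm_sq_to_K] at h1
  have hw2 : 0 < ‖w‖ ^ 2 := by positivity
  have h2 := Complex.nonneg_iff.1 h1
  simp only [Complex.neg_re, Complex.neg_im, Complex.coe_algebraMap, ← Complex.ofReal_pow,
    Complex.re_mul_ofReal, Complex.im_mul_ofReal, Complex.conj_re, Complex.conj_im] at h2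
  have h3 : (0 : ℂ) ≤ -m := by
    rw [Complex.nonneg_iff, Complex.neg_re, Complex.neg_im]
    refine ⟨by nlinarith [h2.1], ?_⟩
    have := h2.2
    rw [neg_mul, neg_neg, eq_comm, mul_eq_zero] at this
    rw [this.resolve_right hw2.ne', neg_zero]
  have h4 := Complex.eq_coe_norm_of_nonneg h3
  rw [norm_neg] at h4
  rw [← h4, neg_neg]

/-- The scalar bound of `resolvent_weight_le`, lifted by the functional calculus and tested on `g`,
where the left side vanishes because `⟪Φ f, f⟫ = 0`. -/
theorem gap_estimate {K : H →L[ℂ] H} (hK : 0 ≤ K) (hinj : Function.Injective K) {f g w : H}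
    (hg : (K ^ (3 / 8 : ℝ) : H →L[ℂ] H) g = f) {d t : ℝ} (hd : 0 < d) (ht : 0 < t)
    (hgap : ∀ x ∈ spectrum ℝ K, 0 < x → d ≤ |1 / √x - t|) (hw : w ≠ 0) {u : ℂ}
    (hwK : K (u • f + (t ^ 2 : ℂ) • w) = w) (hwf : inner ℂ w f = 0) :
    ((inner ℂ (K f) f).re - 1 / t ^ 2 * ‖f‖ ^ 2) / (t ^ 2 * ‖K‖) ≤
      1 / (d * t * √t ^ 3) * ‖g‖ ^ 2 := by
  have hsa : IsSelfAdjoint K := hK.isSelfAdjoint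
  have hne : ∀ x ∈ spectrum ℝ K, 1 - t ^ 2 * x ≠ 0 := by
    intro x hx h
    have hx0 : 0 < x := by
      rcases (spectrum_nonneg_of_nonneg hK hx).eq_or_lt with h0 | h0
      · simp [← h0] at h
      · exact h0
    have h1 : 1 / √x = t := by
      have : x = (1 / t) ^ 2 := by
        field_simp
        linarith
      rw [this, Real.sqrt_sq (by positivity), one_div_one_div]
    have := hgap x hx hx0
    rw [h1, sub_self, abs_zero] at this
    linarith
  have hφc : ContinuousOn (fun x : ℝ => x / (1 - t ^ 2 * x)) (spectrum ℝ K) :=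
    ContinuousOn.div (by fun_prop) (by fun_prop) hne
  have hpc : ContinuousOn (fun x : ℝ => x ^ (3 / 8 : ℝ)) (spectrum ℝ K) :=
    ContinuousOn.rpow_const (by fun_prop) fun _ _ => Or.inr (by norm_num)
  set Φ : H →L[ℂ] H := cfc (fun x : ℝ => x / (1 - t ^ 2 * x)) K with hΦ
  set P : H →L[ℂ] H := cfc (fun x : ℝ => x ^ (3 / 8 : ℝ)) K with hP
  have hPg : P g = f := by
    rw [← hg, CFC.rpow_eq_cfc_real]
  have hPsa : IsSelfAdjoint P := cfc_predicate _ K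
  have hΦK : Φ * (1 - (t ^ 2 : ℝ) • K) = K := by
    have h1 : (1 - (t ^ 2 : ℝ) • K) = cfc (fun x : ℝ => 1 - t ^ 2 * x) K := by
      rw [cfc_sub (fun _ => 1) (fun x => t ^ 2 * x) K, cfc_const_one ℝ K, cfc_const_mul_id _ K]
    rw [h1, hΦ, ← cfc_mul _ _ K]
    conv_rhs => rw [← cfc_id ℝ K]
    refine cfc_congr fun x hx => ?_
    exact div_mul_cancel₀ _ (hne x hx)
  have hcomm : Φ * K = K * Φ := by
    have := cfc_commute_cfc (fun x : ℝ => x / (1 - t ^ 2 * x)) id K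
    rw [cfc_id ℝ K] at this
    exact this
  -- After applying the injective `K`, the identity `Φ (1 - t² K) = K` suffices.
  have hwΦ : w = u • Φ f := by
    apply hinj
    have h1 : (1 - (t ^ 2 : ℝ) • K) w = u • K f := by
      rw [map_add, map_smul, map_smul] at hwK
      rw [sub_apply, one_apply_eq_self, smul_apply, sub_eq_iff_eq_add]
      conv_lhs => rw [← hwK]
      congr 1
      rw [← Complex.ofReal_pow, Complex.coe_smul]
    calc K w = (Φ * (1 - (t ^ 2 : ℝ) • K)) w := by rw [hΦK]
      _ = u • (Φ * K) f := by
        rw [mul_apply_eq_comp, h1, map_smul]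
        rfl
      _ = K (u • Φ f) := by
        rw [hcomm, map_smul]
        rfl
  have hΦf : inner ℂ (Φ f) f = 0 := by
    rw [hwΦ, inner_smul_left, mul_eq_zero] at hwf
    refine hwf.resolve_left fun h => hw ?_
    have : u = 0 := by simpa using h
    rw [hwΦ, this, zero_smul]
  have hpos : P * Φ * P ≤ algebraMap ℝ (H →L[ℂ] H) (1 / (d * t * √t ^ 3)) -
      P * ((1 / (t ^ 2 * ‖K‖)) • (K - (1 / t ^ 2 : ℝ) • 1)) * P := by
    have h1 : P * Φ * P = cfc (fun x : ℝ => x ^ (3 / 8 : ℝ) * (x / (1 - t ^ 2 * x)) *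
        x ^ (3 / 8 : ℝ)) K := by
      have hpφ : ContinuousOn (fun x : ℝ => x ^ (3 / 8 : ℝ) * (x / (1 - t ^ 2 * x)))
          (spectrum ℝ K) := hpc.mul hφc
      rw [cfc_mul _ _ K hpφ hpc, cfc_mul _ _ K hpc hφc]
    have h2 : algebraMap ℝ (H →L[ℂ] H) (1 / (d * t * √t ^ 3)) -
        P * ((1 / (t ^ 2 * ‖K‖)) • (K - (1 / t ^ 2 : ℝ) • 1)) * P =
        cfc (fun x : ℝ => 1 / (d * t * √t ^ 3) -
          x ^ (3 / 8 : ℝ) * (1 / (t ^ 2 * ‖K‖) * (x - 1 / t ^ 2)) * x ^ (3 / 8 : ℝ)) K := by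
      have hc : ContinuousOn (fun x : ℝ => 1 / (t ^ 2 * ‖K‖) * (x - 1 / t ^ 2)) (spectrum ℝ K) := by
        fun_prop
      have hpx : ContinuousOn (fun x : ℝ => x ^ (3 / 8 : ℝ) *
          (1 / (t ^ 2 * ‖K‖) * (x - 1 / t ^ 2))) (spectrum ℝ K) := hpc.mul hc
      have hpxp : ContinuousOn (fun x : ℝ => x ^ (3 / 8 : ℝ) *
          (1 / (t ^ 2 * ‖K‖) * (x - 1 / t ^ 2)) * x ^ (3 / 8 : ℝ)) (spectrum ℝ K) := hpx.mul hpc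
      rw [cfc_sub _ _ K continuousOn_const hpxp, cfc_const _ K, cfc_mul _ _ K hpx hpc,
        cfc_mul _ _ K hpc hc, cfc_const_mul _ _ K, cfc_sub _ _ K, cfc_id' ℝ K, cfc_const _ K,
        Algebra.algebraMap_eq_smul_one (1 / t ^ 2)]
    rw [h1, h2]
    refine cfc_mono (fun x hx => ?_) ((hpc.mul hφc).mul hpc)
      (continuousOn_const.sub ((hpc.mul (by fun_prop)).mul hpc))
    have hxN : x ≤ ‖K‖ := by
      -- The bound of the spectrum by the norm uses `‖1‖ = 1`.
      have : Nontrivial H := ⟨w, 0, hw⟩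
      exact (le_abs_self x).trans (spectrum.norm_le_norm_of_mem hx)
    have := resolvent_weight_le (spectrum_nonneg_of_nonneg hK hx) hxN hd ht (hgap x hx)
    rwa [div_eq_inv_mul (x - 1 / t ^ 2), ← one_div] at this
  rw [ContinuousLinearMap.le_def] at hpos
  have hre := hpos.re_inner_nonneg_left g
  have hsym : ∀ X : H →L[ℂ] H, inner ℂ ((P * X * P) g) g = inner ℂ (X f) f := by
    intro X
    rw [mul_apply_eq_comp, mul_apply_eq_comp, hPg]
    exact (hPsa.isSymmetric _ _).trans (by rw [← hPg]; rfl)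
  rw [sub_apply, sub_apply, inner_sub_left, inner_sub_left, hsym, hsym, hΦf, sub_zero,
    Algebra.algebraMap_eq_smul_one, smul_apply, smul_apply, sub_apply, smul_apply,
    one_apply_eq_self, one_apply_eq_self, ← Complex.coe_smul, ← Complex.coe_smul, ← Complex.coe_smul, inner_smul_left,
    inner_smul_left, inner_sub_left, inner_smul_left, inner_self_eq_norm_sq_to_K,
    inner_self_eq_norm_sq_to_K] at hre
  simp only [Complex.conj_ofReal, RCLike.re_to_complex, Complex.sub_re, Complex.re_ofReal_mul,
    Complex.coe_algebraMap, ← Complex.ofReal_pow, Complex.ofReal_re] at hre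
  rw [div_eq_inv_mul, ← one_div]
  linarith

end Bounded

end SISO

end

/-! ### Choice of the constant and the contradiction. -/

open SISO in
theorem mainTheorem7 {H : Type*} [NormedAddCommGroup H] [InnerProductSpace ℂ H] [CompleteSpace H]
    (T : SISO.StiffnessOperator H) (F : ℂ →L[ℂ] H) (f : H) (hF : ∀ u : ℂ, F u = u • f)
    (hf : f ∈ (T.fracPow (3 / 8)).domain)
    (hspec : SISO.HasDiscreteSpectrum T.generator)
    (hmin : SISO.IsMinimal T.generator (T.inputOp F)
      (ContinuousLinearMap.adjoint (T.inputOp F)) 0) :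
    ∃ M : ℝ, 0 < M ∧
      ∀ μ ∈ SISO.invariantZeros T.generator (T.inputOp F)
          (ContinuousLinearMap.adjoint (T.inputOp F)) 0,
        ∃ l : ℂ, SISO.IsEigenvalue T.generator l ∧
          (μ ≠ 0 → ‖μ - l‖ < M / √‖μ‖) := by
  have hB : ∀ u, T.inputOp F u = WithLp.toLp 2 (0, u • f) := fun u => by
    rw [← hF]
    rfl
  have hnot : ∀ μ ∈ invariantZeros T.generator (T.inputOp F)
      (ContinuousLinearMap.adjoint (T.inputOp F)) 0, μ ∉ spec T.generator := fun μ h1 h2 =>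
    (Set.mem_empty_iff_false μ).1 (hmin ▸ ⟨h1, h2⟩)
  by_cases hf0 : f = 0
  -- For `f = 0` every invariant zero is an eigenvalue, so minimality leaves none.
  · refine ⟨1, one_pos, fun μ hμ => absurd ?_ (hnot μ hμ)⟩
    obtain ⟨z, u, hz0, hz, -⟩ := hμ
    refine IsEigenvalue.mem_spec ⟨z, hz0, ?_⟩
    rw [hB, hf0, smul_zero] at hz
    exact (sub_eq_zero.1 ((sub_zero _).symm.trans hz)).symm
  obtain ⟨g, hg⟩ := (T.mem_fracPow_domain _ _).1 hf
  have hc : 0 < (inner ℂ (T.inv f) f).re := by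
    obtain ⟨x, hx, hxf⟩ := T.inv_spec f
    have hx0 : (x : H) ≠ 0 := fun h => hf0 (by rw [← hxf, (Subtype.ext h : x = 0), LinearPMap.map_zero])
    have := T.pos x hx0
    rw [hxf, hx] at this
    exact this.trans_eq (inner_re_symm (𝕜 := ℂ) f (T.inv f))
  set c := (inner ℂ (T.inv f) f).re
  have hK0 : T.inv ≠ 0 := fun h => hf0 (T.inv_injective (by rw [h]; rfl))
  have hN : 0 < ‖T.inv‖ := norm_pos_iff.2 hK0
  obtain ⟨l₀, hl₀⟩ : ∃ l, IsEigenvalue T.generator l := by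
    obtain ⟨x, hx, hx0⟩ := exists_pos_mem_spectrum T.inv_nonneg hK0
    refine ⟨_, (hspec.2 (Complex.I * (1 / √x : ℝ)) (T.mem_spec_generator hx ?_)).1⟩
    rw [mul_pow, Complex.I_sq, ← Complex.ofReal_pow, div_pow, Real.sq_sqrt hx0.le]
    have : (x : ℂ) ≠ 0 := by exact_mod_cast hx0.ne'
    push_cast
    field_simp
  -- The condition `t² ≥ S` is what makes `‖f‖² / t² ≤ c/2`.
  set S := 2 * ‖f‖ ^ 2 / c with hS
  have hS0 : 0 ≤ S := by positivity
  -- The first term defeats the estimate for `t² ≥ S`, the second bounds `‖μ - l₀‖ √t` for `t² < S`,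
  -- and `1` gives strictness.
  set M := 2 * ‖T.inv‖ * ‖g‖ ^ 2 / c + (S + 1 + ‖l₀‖) * (S + 1) + 1 with hM
  have hM0 : 0 < M := by positivity
  refine ⟨M, hM0, fun μ hμ => ?_⟩
  by_cases hμ0 : μ = 0
  · exact ⟨l₀, hl₀, fun h => absurd hμ0 h⟩
  have hμs := hnot μ hμ
  set t := ‖μ‖ with ht
  have ht0 : 0 < t := norm_pos_iff.2 hμ0
  have hr0 : 0 < √t := Real.sqrt_pos.2 ht0
  have hrt : √t ^ 2 = t := Real.sq_sqrt ht0.le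
  rcases lt_or_ge (t ^ 2) S with hts | hts
  · refine ⟨l₀, hl₀, fun _ => ?_⟩
    rw [lt_div_iff₀ hr0]
    have h1 : t < S + 1 := by nlinarith
    have h2 : √t ≤ S + 1 := Real.sqrt_le_iff.2 ⟨by positivity, by nlinarith⟩
    calc ‖μ - l₀‖ * √t ≤ (t + ‖l₀‖) * √t := by gcongr; exact norm_sub_le _ _
      _ ≤ (S + 1 + ‖l₀‖) * (S + 1) := by gcongr
      _ < M := by
        have : 0 ≤ 2 * ‖T.inv‖ * ‖g‖ ^ 2 / c := by positivity
        linarith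
  by_contra! hcon
  obtain ⟨z, u, hz0, hz, hz'⟩ := hμ
  rw [hB, sub_eq_zero] at hz
  obtain ⟨hv, hwK⟩ := T.generator_resolvent_eq z hz
  set w := T.incl (z : T.State).fst with hw
  have hw0 : w ≠ 0 := by
    intro h
    apply hz0
    apply (WithLp.equiv 2 _).injective
    refine Prod.ext (Subtype.ext h) ?_
    change (z : T.State).snd = 0
    rw [hv, h, smul_zero]
  have hwf : inner ℂ w f = 0 := by
    rw [zero_mul, add_zero] at hz'
    have h1 : inner ℂ (z : T.State) (T.inputOp F 1) = 0 := by
      rw [← ContinuousLinearMap.adjoint_inner_left, hz', inner_zero_left]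
    rw [hB, one_smul, WithLp.prod_inner_apply] at h1
    have h2 : inner ℂ (z : T.State).snd f = 0 := by
      have h3 : inner ℂ (z : T.State).fst (0 : T.EnergySpace) = 0 := inner_zero_right _
      simpa [h3] using h1
    rw [hv, inner_smul_left, mul_eq_zero] at h2
    exact h2.resolve_left (by simpa using hμ0)
  have hμ2 : μ ^ 2 = -(t ^ 2 : ℂ) := by
    have h := eq_neg_norm_of_apply_eq T.inv_nonneg hw0 hwf hwK
    rwa [norm_pow, Complex.ofReal_pow] at h
  have hd : 0 < M / √t := by positivity
  have hgap : ∀ x ∈ spectrum ℝ T.inv, 0 < x → M / √t ≤ |1 / √x - t| := by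
    intro x hx hx0
    have hxC : (x : ℂ) ≠ 0 := by exact_mod_cast hx0.ne'
    have htC : (t : ℂ) ≠ 0 := by exact_mod_cast ht0.ne'
    set r := 1 / √x with hr
    have hr2 : r ^ 2 * x = 1 := by
      rw [hr, div_pow, Real.sq_sqrt hx0.le]
      field_simp
    -- The eigenvalue `(r/t) μ` is the one of `±i r` on the ray of `μ`, so its distance to `μ` is
    -- exactly `|r - t|`.
    have hl : ((r / t : ℝ) * μ) ^ 2 * x = -1 := by
      have : (r : ℂ) ^ 2 * x = 1 := by exact_mod_cast hr2
      rw [mul_pow, hμ2]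
      push_cast
      field_simp
      rw [this]
    have h1 := (hcon _ (hspec.2 _ (T.mem_spec_generator hx hl)).1).2
    have h2 : μ - (r / t : ℝ) * μ = ((1 - r / t : ℝ) : ℂ) * μ := by push_cast; ring
    rw [h2, norm_mul, Complex.norm_real, Real.norm_eq_abs, ← ht, ← abs_of_pos ht0, ← abs_mul,
      abs_of_pos ht0, sub_mul, div_mul_cancel₀ _ ht0.ne', one_mul, abs_sub_comm] at h1
    exact h1
  have hwK' : T.inv (u • f + (t ^ 2 : ℂ) • w) = w := by
    rw [hμ2, neg_smul, sub_neg_eq_add] at hwK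
    exact hwK
  have hest := gap_estimate T.inv_nonneg T.inv_injective hg hd ht0 hgap hw0 hwK' hwf
  have h1 : 1 / t ^ 2 * ‖f‖ ^ 2 ≤ c / 2 := by
    rw [hS, div_le_iff₀ hc] at hts
    rw [one_div_mul_eq_div, div_le_iff₀ (by positivity)]
    linarith
  -- The gap `M/√t` and the weight `t^(-3/2)` combine to the order `t²` of the other side, so `t`
  -- cancels.
  have h2 : M / √t * t * √t ^ 3 = M * t ^ 2 := by
    rw [show √t ^ 3 = √t * √t ^ 2 by ring, hrt]
    field_simp
  rw [h2, one_div_mul_eq_div (M * t ^ 2), div_le_div_iff₀ (by positivity) (by positivity)] at hest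
  have h3 : c / 2 * M ≤ ‖g‖ ^ 2 * ‖T.inv‖ := by
    have : c / 2 * (M * t ^ 2) ≤ ‖g‖ ^ 2 * (t ^ 2 * ‖T.inv‖) :=
      le_trans (by gcongr; linarith) hest
    have ht2 : 0 < t ^ 2 := by positivity
    nlinarith
  have h4 : 2 * ‖T.inv‖ * ‖g‖ ^ 2 / c < M := by
    have : 0 ≤ (S + 1 + ‖l₀‖) * (S + 1) := by positivity
    linarith
  rw [div_lt_iff₀ hc] at h4
  linarith
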